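/- Notation. Let $\mathcal Z$ be the space of functions $\varphi:\mathbb R\to\mathbb C$ that extend to entire functions such that, for some $r=r(\varphi)>0$ and all $\varkappa$, $|\varphi(z)|\le C_\varkappa(1+|z|)^{-\varkappa}e^{r|\operatorname{Im}z|}$ for all $z\in\mathbb C$. We say that $\varphi_k\to0$ in $\mathcal Z$ if all $\varphi_k$ satisfy these bounds with the same constants $r$, $C_\varkappa$ and $\varphi_k\to0$ uniformly on compact subsets of $\mathbb C$. For $\gamma\in\mathbb R$ let $\mathcal Z_\gamma$ be the space of functions $f:(0,\infty)\to\mathbb C$ such that $x\mapsto e^{(1/2-\gamma)x}f(e^x)$ belongs to $\mathcal Z$, with the convergence induced by that in $\mathcal Z$. Let $\mathcal Z_\gamma'$ be the space of antilinear functionals on $\mathcal Z_\gamma$ that are continuous with respect to this convergence of sequences, with the topology of pointwise convergence on $\mathcal Z_\gamma$; we write $\langle h,F\rangle$ for the value of $h\in\mathcal Z_\gamma'$ at $F\in\mathcal Z_\gamma$. Let $(\mathsf Lf)(\lambda)=\int_0^\infty e^{-t\lambda}f(t)\,dt$ for $\lambda>0$, let $(\bar f_1\star f_2)(t)=\int_0^t\overline{f_1(s)}f_2(t-s)\,ds$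 for $t>0$, and let $g^*(\lambda)=\overline{g(\lambda)}$ for $\lambda>0$. Theorem. Let $\gamma>0$. (1) For all $f\in\mathcal Z_{\gamma-1/2}$ and $\lambda>0$ the integral $(\mathsf Lf)(\lambda)$ converges absolutely, and $\mathsf L:\mathcal Z_{\gamma-1/2}\to\mathcal Z_{1/2-\gamma}$ is an isomorphism, that is, a linear bijection which is continuous together with its inverse (with respect to the convergence of sequences above). (2) The adjoint map $\mathsf L^*:\mathcal Z_{1/2-\gamma}'\to\mathcal Z_{\gamma-1/2}'$, $\langle\mathsf L^*\sigma,F\rangle=\langle\sigma,\mathsf LF\rangle$ for $F\in\mathcal Z_{\gamma-1/2}$, is an isomorphism (a linear homeomorphism). Thus $\sigma=(\mathsf L^*)^{-1}h$ gives a one-to-one correspondence between kernels $h\in\mathcal Z_{\gamma-1/2}'$ and their sigma-functions $\sigma\in\mathcal Z_{1/2-\gamma}'$. (3) Let $h\in\mathcal Z_{\gamma-1/2}'$ and $\sigma=(\mathsf L^*)^{-1}h\in\mathcal Z_{1/2-\gamma}'$. Then for all $f_1,f_2\in\mathcal Z_{(\gamma-1)/2}$ the integral defining $(\bar f_1\star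 f_2)(t)$ converges absolutely for every $t>0$, one has $\bar f_1\star f_2\in\mathcal Z_{\gamma-1/2}$ and $(\mathsf Lf_1)^*\,\mathsf Lf_2\in\mathcal Z_{1/2-\gamma}$, and $$\langle h,\bar f_1\star f_2\rangle=\langle\sigma,(\mathsf Lf_1)^*\,\mathsf Lf_2\rangle .$$ -/

import Mathlib

open Filter Topology MeasureTheory

noncomputable section

namespace HankelSigma

/-- The half-line `ℝ₊ = (0, ∞)`. -/
abbrev RPos : Type := Set.Ioi (0 : ℝ)

/-- The point `e ^ x` of `ℝ₊`. -/
def expPos (x : ℝ) : RPos := ⟨Real.exp x, Real.exp_pos x⟩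

/-- The bounds `|φ(z)| ≤ C_κ (1 + |z|)^(-κ) e^(r |Im z|)` for all complex `z` and all `κ`.
Since `1 + |z| ≥ 1`, natural exponents `κ` give the same condition as real ones. -/
def ExpTypeBound (r : ℝ) (C : ℕ → ℝ) (φ : ℂ → ℂ) : Prop :=
  ∀ (κ : ℕ) (z : ℂ), (1 + ‖z‖) ^ κ * ‖φ z‖ ≤ C κ * Real.exp (r * |z.im|)

/-- `φ` is an entire function whose restriction to the real line is `u`. -/
def IsEntireExt (u : ℝ → ℂ) (φ : ℂ → ℂ) : Prop :=
  Differentiable ℂ φ ∧ ∀ x : ℝ, φ (x : ℂ) = u x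

/-- The space `𝒵 = 𝒵(ℝ)` of functions on the line which extend to entire functions satisfying
`ExpTypeBound` for some `r > 0` and some constants. By Cauchy's estimates on unit discs, such
functions automatically belong to the Schwartz space. -/
def spaceZ : Submodule ℂ (ℝ → ℂ) where
  carrier := {u | ∃ φ : ℂ → ℂ, IsEntireExt u φ ∧
    ∃ r : ℝ, 0 < r ∧ ∃ C : ℕ → ℝ, ExpTypeBound r C φ}
  zero_mem' := by
    refine ⟨0, ⟨differentiable_const 0, fun x => rfl⟩, 1, one_pos, 0, fun κ z => ?_⟩
    simp
  add_mem' := by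
    rintro u v ⟨φ, ⟨hφ, hu⟩, r, hr, C, hC⟩ ⟨ψ, ⟨hψ, hv⟩, s, hs, D, hD⟩
    refine ⟨φ + ψ, ⟨hφ.add hψ, fun x => by simp [hu, hv]⟩, max r s, lt_max_of_lt_left hr,
      fun κ => |C κ| + |D κ|, fun κ z => ?_⟩
    have h1 : C κ * Real.exp (r * |z.im|) ≤ |C κ| * Real.exp (max r s * |z.im|) := by
      gcongr
      · exact le_abs_self _
      · exact le_max_left _ _
    have h2 : D κ * Real.exp (s * |z.im|) ≤ |D κ| * Real.exp (max r s * |z.im|) := by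
      gcongr
      · exact le_abs_self _
      · exact le_max_right _ _
    calc (1 + ‖z‖) ^ κ * ‖(φ + ψ) z‖
        ≤ (1 + ‖z‖) ^ κ * (‖φ z‖ + ‖ψ z‖) := by
          gcongr
          exact norm_add_le _ _
      _ = (1 + ‖z‖) ^ κ * ‖φ z‖ + (1 + ‖z‖) ^ κ * ‖ψ z‖ := by ring
      _ ≤ (|C κ| + |D κ|) * Real.exp (max r s * |z.im|) := by
          linarith [hC κ z, hD κ z]
  smul_mem' := by
    rintro c u ⟨φ, ⟨hφ, hu⟩, r, hr, C, hC⟩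
    refine ⟨c • φ, ⟨hφ.const_smul c, fun x => by simp [hu]⟩, r, hr, fun κ => ‖c‖ * C κ,
      fun κ z => ?_⟩
    calc (1 + ‖z‖) ^ κ * ‖(c • φ) z‖ = ‖c‖ * ((1 + ‖z‖) ^ κ * ‖φ z‖) := by
          simp only [Pi.smul_apply, smul_eq_mul, norm_mul]
          ring
      _ ≤ ‖c‖ * (C κ * Real.exp (r * |z.im|)) := by
          exact mul_le_mul_of_nonneg_left (hC κ z) (norm_nonneg c)
      _ = ‖c‖ * C κ * Real.exp (r * |z.im|) := by ring

/-- Convergence `u_k → 0` in `𝒵`: the entire extensions satisfy the bounds with common constants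
`r`, `C_κ`, and tend to `0` uniformly on all compact subsets of `ℂ`. -/
def TendstoZeroZ (u : ℕ → ℝ → ℂ) : Prop :=
  ∃ φ : ℕ → ℂ → ℂ, (∀ k, IsEntireExt (u k) (φ k)) ∧
    (∃ r : ℝ, 0 < r ∧ ∃ C : ℕ → ℝ, ∀ k, ExpTypeBound r C (φ k)) ∧
    ∀ K : Set ℂ, IsCompact K → TendstoUniformlyOn φ 0 atTop K

/-- The linear map `f ↦ F`, `F(x) = e^((1/2 - γ) x) f(e^x)`, that is `F = U (t^(-γ) f)` with
`(U f)(x) = e^(x/2) f(e^x)`; equivalently `f(t) = t^(γ - 1/2) F(log t)`. -/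
def toLine (γ : ℝ) : (RPos → ℂ) →ₗ[ℂ] (ℝ → ℂ) where
  toFun f x := (Real.exp ((1 / 2 - γ) * x) : ℂ) * f (expPos x)
  map_add' f g := by
    ext x
    simp [mul_add]
  map_smul' c f := by
    ext x
    simp [mul_left_comm]

/-- The space `𝒵_γ` of functions on `ℝ₊`. -/
def spaceZg (γ : ℝ) : Submodule ℂ (RPos → ℂ) := spaceZ.comap (toLine γ)

/-- Convergence `f_k → 0` in `𝒵_γ`, induced by that in `𝒵`. -/
def TendstoZero {γ : ℝ} (f : ℕ → spaceZg γ) : Prop :=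
  TendstoZeroZ fun k => toLine γ (f k)

/-- The dual space `𝒵_γ'`: continuous antilinear functionals on `𝒵_γ`. -/
def dualZg (γ : ℝ) : Submodule ℂ (spaceZg γ →ₛₗ[starRingEnd ℂ] ℂ) where
  carrier := {h | ∀ f : ℕ → spaceZg γ, TendstoZero f → Tendsto (fun k => h (f k)) atTop (𝓝 0)}
  zero_mem' := fun f _ => by simp
  add_mem' := fun {h g} hh hg f hf => by simpa using (hh f hf).add (hg f hf)
  smul_mem' := fun c h hh f hf => by simpa using (hh f hf).const_mul c

/-- The duality `⟨h, F⟩`, linear in `h` and antilinear in `F`. -/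
def pairing {γ : ℝ} (h : dualZg γ) (F : spaceZg γ) : ℂ := h.1 F

/-- The weak topology on `𝒵_γ'`: pointwise convergence on `𝒵_γ`. -/
instance dualTopology (γ : ℝ) : TopologicalSpace (dualZg γ) :=
  TopologicalSpace.induced (fun h F => pairing h F) Pi.topologicalSpace

/-- The extension of a function on `ℝ₊` by zero to the line. -/
def zeroExt (f : RPos → ℂ) (t : ℝ) : ℂ := if ht : 0 < t then f ⟨t, ht⟩ else 0

/-- The integrand `e^(-t lam) f(t)` of the Laplace transform. -/
def laplaceIntegrand (f : RPos → ℂ) (lam : RPos) (t : ℝ) : ℂ :=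
  (Real.exp (-(t * lam)) : ℂ) * zeroExt f t

/-- The Laplace transform `(L f)(lam) = ∫₀^∞ e^(-t lam) f(t) dt`, `lam > 0`. -/
def laplace (f : RPos → ℂ) (lam : RPos) : ℂ :=
  ∫ t in Set.Ioi (0 : ℝ), laplaceIntegrand f lam t

/-- The integrand `conj f₁(s) f₂(t - s)` of the Laplace convolution. -/
def convIntegrand (f₁ f₂ : RPos → ℂ) (t : RPos) (s : ℝ) : ℂ :=
  starRingEnd ℂ (zeroExt f₁ s) * zeroExt f₂ (t - s)

/-- The Laplace convolution `(conj f₁ ⋆ f₂)(t) = ∫₀^t conj f₁(s) f₂(t - s) ds`. -/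
def laplaceConv (f₁ f₂ : RPos → ℂ) (t : RPos) : ℂ :=
  ∫ s in (0 : ℝ)..t, convIntegrand f₁ f₂ t s

/-- The function `(g₁)^* g₂` on `ℝ₊`, where `g^*(lam) = conj (g (conj lam))`. -/
def conjMul (g₁ g₂ : RPos → ℂ) (lam : RPos) : ℂ := starRingEnd ℂ (g₁ lam) * g₂ lam

end HankelSigma

end

/-! In the variables `t = e^x`, `lam = e^y` the Laplace transform becomes the correlation `u ↦ ∫
K(s) u(s - y) ds` with `K(s) = e^(-e^s) e^(γ s)` (`toLine_laplace`), whose Fourier transform is `Γ(γ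
- 2πiξ)` (`fourier_gammaKernel`). Correlation with a kernel having all moments preserves the space
`𝒵`, the type `r` and null sequences (`corr_bound`, `tendstoUniformlyOn_corr`).

The inverse comes from Paley–Wiener: a function of type `r` has Fourier transform supported in a
bounded interval (`fourier_eq_zero_of_type_lt`), so only the values of the symbol there matter.
Since `1/Γ` is entire, the reciprocal symbol is smooth; cut off outside that interval, it is the
transform of a Schwartz kernel `M`, and correlation with `M` inverts correlation with `K` on
functions of type `r` (`exists_inverse_kernel`). The growth of `1/Γ` along vertical lines thus does
no harm. `M` depends on `r` alone, and a null sequence has a common `r`, so the inverse is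
sequentially continuous.

The statement on duals is formal. The last identity is the convolution theorem for Laplace
transforms (`laplace_laplaceConv`). The membership claims rest on two facts: Laplace transforms with
parameter `γ/2` multiply to parameter `γ`, and in logarithmic variables the convolution is an
average of products of translates against a beta weight (`betaIntegrand_bound`,
`toLine_laplaceConv`). -/

noncomputable section

namespace HankelSigma

/-! ### Parametric integrals and exponential type bounds -/

/-- A parametric integral of entire functions which is dominated on every ball is entire. -/
theorem differentiable_integral_of_dominated {α : Type*} [MeasurableSpace α] {μ : Measure α}
    {Φ : ℂ → α → ℂ} (hm : ∀ z, AEStronglyMeasurable (Φ z) μ)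
    (hd : ∀ a, Differentiable ℂ fun z => Φ z a)
    (hb : ∀ R : ℝ, ∃ b : α → ℝ, Integrable b μ ∧
      ∀ᵐ a ∂μ, ∀ z : ℂ, ‖z‖ ≤ R → ‖Φ z a‖ ≤ b a) :
    Differentiable ℂ fun z => ∫ a, Φ z a ∂μ := by
  intro z₀
  -- Radius `‖z₀‖ + 2` contains the unit circle about every point of the unit ball at `z₀`, so
  -- Cauchy's estimate bounds the derivative by the same `b`.
  obtain ⟨b, hbi, hbb⟩ := hb (‖z₀‖ + 2)
  have hder : ∀ᵐ a ∂μ, ∀ z ∈ Metric.ball z₀ 1, ‖deriv (fun w => Φ w a) z‖ ≤ b a := by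
    filter_upwards [hbb] with a ha z hz
    have h := Complex.norm_deriv_le_of_forall_mem_sphere_norm_le (c := z) (R := 1) (C := b a)
      (f := fun w => Φ w a) one_pos (hd a).diffContOnCl (fun w hw => ha w ?_)
    · simpa using h
    · have h1 : dist w z = 1 := hw
      have h2 : dist z z₀ < 1 := hz
      have h3 : ‖w‖ ≤ ‖z₀‖ + dist w z₀ := by
        rw [dist_eq_norm]
        simpa using norm_add_le z₀ (w - z₀)
      linarith [dist_triangle w z z₀]
  -- The derivative is a pointwise limit of measurable difference quotients with increments
  -- `1/(n+1)`.
  have hmeas : AEStronglyMeasurable (fun a => deriv (fun w => Φ w a) z₀) μ := by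
    have hlim : Tendsto (fun n : ℕ => ((n : ℂ) + 1)⁻¹) atTop (𝓝[≠] 0) := by
      refine tendsto_nhdsWithin_iff.2 ⟨?_, Eventually.of_forall fun n => ?_⟩
      · have := tendsto_one_div_add_atTop_nhds_zero_nat (𝕜 := ℂ)
        simpa using this
      · exact inv_ne_zero (Nat.cast_add_one_ne_zero n)
    refine aestronglyMeasurable_of_tendsto_ae atTop
      (f := fun (n : ℕ) a => (((n : ℂ) + 1)⁻¹)⁻¹ • (Φ (z₀ + ((n : ℂ) + 1)⁻¹) a - Φ z₀ a))
      (fun n => by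
        exact ((hm (z₀ + ((n : ℂ) + 1)⁻¹)).sub (hm z₀)).const_smul (((n : ℂ) + 1)⁻¹)⁻¹)
      (Eventually.of_forall fun a => ?_)
    exact ((hd a z₀).hasDerivAt.tendsto_slope_zero).comp hlim
  refine (hasDerivAt_integral_of_dominated_loc_of_deriv_le (bound := b)
    (Metric.ball_mem_nhds z₀ one_pos) (Eventually.of_forall hm) ?_ hmeas hder hbi
    (Eventually.of_forall fun a z _ => (hd a z).hasDerivAt)).2.differentiableAt
  refine hbi.mono' (hm z₀) ?_
  filter_upwards [hbb] with a ha using ha z₀ (by linarith)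

theorem ExpTypeBound.nonneg {r : ℝ} {C : ℕ → ℝ} {φ : ℂ → ℂ} (h : ExpTypeBound r C φ) (κ : ℕ) :
    0 ≤ C κ := by
  have := h κ 0
  simp only [norm_zero, add_zero, one_pow, one_mul, Complex.zero_im, abs_zero, mul_zero,
    Real.exp_zero, mul_one] at this
  exact (norm_nonneg _).trans this

theorem ExpTypeBound.norm_le {r : ℝ} {C : ℕ → ℝ} {φ : ℂ → ℂ} (h : ExpTypeBound r C φ) (z : ℂ) :
    ‖φ z‖ ≤ C 0 * Real.exp (r * |z.im|) := by simpa using h 0 z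

theorem ExpTypeBound.norm_real_le {r : ℝ} {C : ℕ → ℝ} {φ : ℂ → ℂ} (h : ExpTypeBound r C φ)
    (x : ℝ) : ‖φ x‖ ≤ C 0 := by simpa using h 0 x

theorem norm_le_div_sq {r : ℝ} {C : ℕ → ℝ} {φ : ℂ → ℂ} (h : ExpTypeBound r C φ) (z : ℂ) :
    ‖φ z‖ ≤ C 2 * Real.exp (r * |z.im|) * (1 + ‖z‖) ^ (-2 : ℝ) := by
  have h1 : (0 : ℝ) < (1 + ‖z‖) := by positivity
  rw [Real.rpow_neg h1.le, ← div_eq_mul_inv, le_div_iff₀ (by positivity), mul_comm]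
  exact_mod_cast h 2 z

theorem ExpTypeBound.integrable {r : ℝ} {C : ℕ → ℝ} {φ : ℂ → ℂ} (h : ExpTypeBound r C φ)
    (hd : Differentiable ℂ φ) : Integrable fun x : ℝ => φ x := by
  have hi : Integrable fun x : ℝ => C 2 * (1 + ‖x‖) ^ (-2 : ℝ) :=
    (integrable_one_add_norm (by simp)).const_mul _
  refine hi.mono' (hd.continuous.comp Complex.continuous_ofReal).aestronglyMeasurable
    (Eventually.of_forall fun x => ?_)
  simpa using norm_le_div_sq h x

/-! ### Correlation with rapidly decaying kernels -/

/-- Kernels on the line all of whose absolute moments are finite. -/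
def RapidKernel (K : ℝ → ℂ) : Prop :=
  AEStronglyMeasurable K ∧ ∀ κ : ℕ, Integrable fun s : ℝ => (1 + |s|) ^ κ * ‖K s‖

theorem RapidKernel.integrable {K : ℝ → ℂ} (hK : RapidKernel K) : Integrable K := by
  have := hK.2 0
  simp only [pow_zero, one_mul] at this
  exact (integrable_norm_iff hK.1).1 this

/-- The correlation `z ↦ ∫ K(s) φ(s - z) ds` of a kernel with an entire function. -/
def corr (K : ℝ → ℂ) (φ : ℂ → ℂ) (z : ℂ) : ℂ := ∫ s : ℝ, K s * φ (s - z)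

/-- Peetre's inequality: it splits the weight in `z` between the moments of the kernel and the decay
of the function. -/
theorem one_add_norm_pow_le (z : ℂ) (s : ℝ) (κ : ℕ) :
    (1 + ‖z‖) ^ κ ≤ (1 + |s|) ^ κ * (1 + ‖(s : ℂ) - z‖) ^ κ := by
  rw [← mul_pow]
  have h1 : ‖z‖ ≤ |s| + ‖(s : ℂ) - z‖ := by
    have := norm_sub_le (s : ℂ) (s - z)
    simpa using this
  have h2 : 0 ≤ |s| * ‖(s : ℂ) - z‖ := by positivity
  gcongr
  linarith

/-- The type `r` is unchanged because `s` is real, so that `|Im (s - z)| = |Im z|`; the constants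
pick up the moments of `K`. -/
theorem corr_bound {K : ℝ → ℂ} (hK : RapidKernel K) {r : ℝ} {C : ℕ → ℝ} {φ : ℂ → ℂ}
    (h : ExpTypeBound r C φ) :
    ExpTypeBound r (fun κ => (∫ s : ℝ, (1 + |s|) ^ κ * ‖K s‖) * C κ) (corr K φ) := by
  intro κ z
  rw [mul_assoc, ← integral_mul_const]
  have hz : (0 : ℝ) ≤ (1 + ‖z‖) ^ κ := by positivity
  calc (1 + ‖z‖) ^ κ * ‖corr K φ z‖ = ‖((1 + ‖z‖) ^ κ : ℝ) • corr K φ z‖ := by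
        rw [norm_smul, Real.norm_of_nonneg hz]
    _ = ‖∫ s : ℝ, ((1 + ‖z‖) ^ κ : ℝ) • (K s * φ (s - z))‖ := by rw [corr, integral_smul]
    _ ≤ _ := by
      refine norm_integral_le_of_norm_le ((hK.2 κ).mul_const _)
        (Eventually.of_forall fun s => ?_)
      have h1 := h κ (s - z)
      simp only [Complex.sub_im, Complex.ofReal_im, zero_sub, abs_neg] at h1
      rw [norm_smul, Real.norm_of_nonneg hz, norm_mul]
      calc (1 + ‖z‖) ^ κ * (‖K s‖ * ‖φ (s - z)‖)
          ≤ ((1 + |s|) ^ κ * (1 + ‖(s : ℂ) - z‖) ^ κ) * (‖K s‖ * ‖φ (s - z)‖) := by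
            gcongr
            exact one_add_norm_pow_le z s κ
        _ = (1 + |s|) ^ κ * ‖K s‖ * ((1 + ‖(s : ℂ) - z‖) ^ κ * ‖φ (s - z)‖) := by ring
        _ ≤ _ := by gcongr

theorem differentiable_corr {K : ℝ → ℂ} (hK : RapidKernel K) {r : ℝ} (hr : 0 ≤ r) {C : ℕ → ℝ}
    {φ : ℂ → ℂ} (hd : Differentiable ℂ φ) (h : ExpTypeBound r C φ) :
    Differentiable ℂ (corr K φ) := by
  refine differentiable_integral_of_dominated (fun z => hK.1.mul ?_)
    (fun s => (hd.comp ((differentiable_const _).sub differentiable_id)).const_mul _)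
    fun R => ⟨fun s => ‖K s‖ * (C 0 * Real.exp (r * R)), hK.integrable.norm.mul_const _,
      Eventually.of_forall fun s z hz => ?_⟩
  · exact (hd.continuous.comp (by fun_prop)).aestronglyMeasurable
  · rw [norm_mul]
    have h1 := h.norm_le (s - z)
    simp only [Complex.sub_im, Complex.ofReal_im, zero_sub, abs_neg] at h1
    have h2 := h.nonneg 0
    refine mul_le_mul_of_nonneg_left (h1.trans ?_) (norm_nonneg _)
    gcongr
    exact (Complex.abs_im_le_norm z).trans hz

/-- Eventually `‖φ k (s - z)‖ ≤ δ (1 + |s|)` for all real `s` and all `z` in the compact set: for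
`|s| ≤ T` by uniform convergence on a ball, for larger `|s|` by the common bound. Integration then
costs one moment of `K`. -/
theorem tendstoUniformlyOn_corr {K : ℝ → ℂ} (hK : RapidKernel K) {r : ℝ} (hr : 0 ≤ r)
    {C : ℕ → ℝ} {φ : ℕ → ℂ → ℂ} (h : ∀ k, ExpTypeBound r C (φ k))
    (hφ : ∀ S : Set ℂ, IsCompact S → TendstoUniformlyOn φ 0 atTop S) (S : Set ℂ)
    (hS : IsCompact S) : TendstoUniformlyOn (fun k => corr K (φ k)) 0 atTop S := by
  obtain ⟨M, hM⟩ := hS.isBounded.exists_norm_le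
  set A : ℝ := ∫ s : ℝ, (1 + |s|) ^ 1 * ‖K s‖
  have hA : 0 ≤ A := integral_nonneg fun s => by positivity
  rw [Metric.tendstoUniformlyOn_iff]
  intro ε hε
  set δ : ℝ := ε / (A + 1)
  have hδ : 0 < δ := by positivity
  have hC := (h 0).nonneg 0
  -- Beyond this `T` the uniform bound on the strip `|Im z| ≤ M` is already below `δ |s|`.
  obtain ⟨T, hT0, hT⟩ : ∃ T : ℝ, 0 ≤ T ∧ C 0 * Real.exp (r * M) ≤ δ * T := by
    refine ⟨C 0 * Real.exp (r * M) / δ, by positivity, ?_⟩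
    rw [mul_div_cancel₀ _ hδ.ne']
  have := Metric.tendstoUniformlyOn_iff.1
    (hφ _ (isCompact_closedBall (0 : ℂ) (T + M))) δ hδ
  filter_upwards [this] with k hk z hz
  have key : ∀ s : ℝ, ‖φ k (s - z)‖ ≤ δ * (1 + |s|) := by
    intro s
    by_cases hs : |s| ≤ T
    · have h1 : (s : ℂ) - z ∈ Metric.closedBall (0 : ℂ) (T + M) := by
        rw [mem_closedBall_zero_iff]
        refine (norm_sub_le _ _).trans (add_le_add ?_ (hM z hz))
        simpa using hs
      have h2 := hk _ h1
      rw [Pi.zero_apply, dist_zero_left] at h2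
      nlinarith [abs_nonneg s]
    · have h1 := (h k).norm_le (s - z)
      simp only [Complex.sub_im, Complex.ofReal_im, zero_sub, abs_neg] at h1
      have h2 : Real.exp (r * |z.im|) ≤ Real.exp (r * M) := by
        gcongr
        exact (Complex.abs_im_le_norm z).trans (hM z hz)
      have h3 : C 0 * Real.exp (r * |z.im|) ≤ C 0 * Real.exp (r * M) := by gcongr
      have h4 : δ * T ≤ δ * (1 + |s|) := by
        gcongr
        linarith
      linarith
  rw [Pi.zero_apply, dist_zero_left]
  calc ‖corr K (φ k) z‖ ≤ ∫ s : ℝ, δ * ((1 + |s|) ^ 1 * ‖K s‖) := by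
        refine norm_integral_le_of_norm_le ((hK.2 1).const_mul _)
          (Eventually.of_forall fun s => ?_)
        rw [norm_mul]
        calc ‖K s‖ * ‖φ k (s - z)‖ ≤ ‖K s‖ * (δ * (1 + |s|)) := by
              gcongr
              exact key s
          _ = _ := by ring
    _ = δ * A := integral_const_mul _ _
    _ < δ * (A + 1) := by gcongr; linarith
    _ = ε := by
      simp only [δ]
      field_simp

/-- The correlation on functions on the line. -/
def corrLine (K u : ℝ → ℂ) (y : ℝ) : ℂ := ∫ s : ℝ, K s * u (s - y)

theorem IsEntireExt.corr {K u : ℝ → ℂ} (hK : RapidKernel K) {r : ℝ} (hr : 0 ≤ r) {C : ℕ → ℝ}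
    {φ : ℂ → ℂ} (hu : IsEntireExt u φ) (h : ExpTypeBound r C φ) :
    IsEntireExt (corrLine K u) (corr K φ) := by
  refine ⟨differentiable_corr hK hr hu.1 h, fun x => ?_⟩
  simp only [HankelSigma.corr, corrLine, ← hu.2, Complex.ofReal_sub]

theorem corrLine_mem_spaceZ {K u : ℝ → ℂ} (hK : RapidKernel K) (hu : u ∈ spaceZ) :
    corrLine K u ∈ spaceZ := by
  obtain ⟨φ, hφ, r, hr, C, hC⟩ := hu
  exact ⟨_, hφ.corr hK hr.le hC, r, hr, _, corr_bound hK hC⟩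

theorem TendstoZeroZ.corrLine {K : ℝ → ℂ} (hK : RapidKernel K) {u : ℕ → ℝ → ℂ}
    (hu : TendstoZeroZ u) : TendstoZeroZ fun k => corrLine K (u k) := by
  obtain ⟨φ, hφ, ⟨r, hr, C, hC⟩, h⟩ := hu
  exact ⟨_, fun k => (hφ k).corr hK hr.le (hC k), ⟨r, hr, _, fun k => corr_bound hK (hC k)⟩,
    tendstoUniformlyOn_corr hK hr.le hC h⟩

/-! ### Fourier transform: injectivity, Paley–Wiener vanishing, prescribed symbols -/

section

open FourierTransform Convolution ContDiff

/-- A correlation is the convolution of `K` with the reflection of `u`, which accounts for the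
argument `-ξ`. -/
theorem fourier_corrLine {K u : ℝ → ℂ} (hK : Integrable K) (hu : Integrable u) (ξ : ℝ) :
    𝓕 (corrLine K u) ξ = 𝓕 K ξ * 𝓕 u (-ξ) := by
  have h1 : corrLine K u = K ⋆[ContinuousLinearMap.mul ℂ ℂ] fun x => u (-x) := by
    ext y
    simp [corrLine, convolution]
  rw [h1, Real.fourier_mul_convolution_eq hK hu.comp_neg]
  congr 1
  simp only [Real.fourier_eq, RCLike.inner_apply, conj_trivial]
  rw [← integral_neg_eq_self]
  simp

theorem eq_of_fourier_eq {u v : ℝ → ℂ} (hu : Continuous u) (hv : Continuous v)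
    (hui : Integrable u) (hvi : Integrable v) (h : 𝓕 u = 𝓕 v) : u = v := by
  have h0 : 𝓕 (u - v) = 0 := by
    ext ξ
    have h1 := (Real.fourierIntegral_convergent_iff (f := u) ξ).2 hui
    have h2 := (Real.fourierIntegral_convergent_iff (f := v) ξ).2 hvi
    have h3 := congrFun h ξ
    rw [Real.fourier_eq, Real.fourier_eq] at h3
    rw [Real.fourier_eq]
    simp only [Pi.sub_apply, smul_sub, Pi.zero_apply]
    rw [integral_sub h1 h2, h3, sub_self]
  have h1 := (hu.sub hv).fourierInv_fourier_eq (hui.sub hvi) (by rw [h0]; exact integrable_zero _ _ _)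
  rw [h0] at h1
  have h2 : 𝓕⁻ (0 : ℝ → ℂ) = 0 := by
    ext ξ
    simp [Real.fourierInv_eq]
  rw [h2] at h1
  exact (sub_eq_zero.1 h1.symm)

/-- Supplies one integrable majorant in `x` for all shifts `w` in a ball, as needed to differentiate
the shifted Fourier integral in `w`. -/
theorem norm_shift_le {r : ℝ} (hr : 0 ≤ r) {C : ℕ → ℝ} {φ : ℂ → ℂ} (h : ExpTypeBound r C φ)
    {w : ℂ} {R : ℝ} (hw : ‖w‖ ≤ R) (x : ℝ) :
    ‖φ (x + w)‖ ≤ (1 + R) ^ 2 * C 2 * Real.exp (r * R) * (1 + ‖x‖) ^ (-2 : ℝ) := by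
  have h1 : (0 : ℝ) < 1 + ‖x‖ := by positivity
  rw [Real.rpow_neg h1.le, ← div_eq_mul_inv, le_div_iff₀ (by positivity), mul_comm]
  have hC := h.nonneg 2
  have h2 := h 2 (x + w)
  have h4 : 1 + ‖x‖ ≤ (1 + R) * (1 + ‖(x : ℂ) + w‖) := by
    have h5 : ‖x‖ ≤ ‖(x : ℂ) + w‖ + ‖w‖ := by
      have := norm_sub_le ((x : ℂ) + w) w
      simpa using this
    have h6 : 0 ≤ ‖w‖ := norm_nonneg w
    have h7 : 0 ≤ ‖(x : ℂ) + w‖ := norm_nonneg _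
    nlinarith
  have h5 : |((x : ℂ) + w).im| ≤ R := by
    simpa using (Complex.abs_im_le_norm w).trans hw
  calc (1 + ‖x‖) ^ (2 : ℝ) * ‖φ (x + w)‖ = (1 + ‖x‖) ^ 2 * ‖φ (x + w)‖ := by norm_cast
    _ ≤ ((1 + R) * (1 + ‖(x : ℂ) + w‖)) ^ 2 * ‖φ (x + w)‖ := by gcongr
    _ = (1 + R) ^ 2 * ((1 + ‖(x : ℂ) + w‖) ^ 2 * ‖φ (x + w)‖) := by ring
    _ ≤ (1 + R) ^ 2 * (C 2 * Real.exp (r * |((x : ℂ) + w).im|)) := by gcongr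
    _ ≤ (1 + R) ^ 2 * (C 2 * Real.exp (r * R)) := by gcongr
    _ = _ := by ring

/-- Shifting the contour of a Fourier integral to a horizontal line. -/
theorem integral_shift_eq {r : ℝ} (hr : 0 ≤ r) {C : ℕ → ℝ} {φ : ℂ → ℂ}
    (h : ExpTypeBound r C φ) (hd : Differentiable ℂ φ) (ξ : ℝ) (w : ℂ) :
    ∫ x : ℝ, Complex.exp (-(2 * Real.pi * ξ * x : ℝ) * Complex.I) * φ (x + w) =
      Complex.exp (2 * Real.pi * ξ * w * Complex.I) *
        ∫ x : ℝ, Complex.exp (-(2 * Real.pi * ξ * x : ℝ) * Complex.I) * φ x := by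
  have hn : ∀ x : ℝ, ‖Complex.exp (-(2 * Real.pi * ξ * x : ℝ) * Complex.I)‖ = 1 := fun x => by
    rw [← Complex.ofReal_neg, Complex.norm_exp_ofReal_mul_I]
  have hJ : Differentiable ℂ fun w : ℂ =>
      ∫ x : ℝ, Complex.exp (-(2 * Real.pi * ξ * x : ℝ) * Complex.I) * φ (x + w) := by
    refine differentiable_integral_of_dominated (fun z => ?_)
      (fun s => (hd.comp ((differentiable_const _).add differentiable_id)).const_mul _)
      fun R => ⟨_, (integrable_one_add_norm (E := ℝ) (r := 2) (by simp)).const_mul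
        ((1 + R) ^ 2 * C 2 * Real.exp (r * R)), Eventually.of_forall fun x z hz => ?_⟩
    · have hc := hd.continuous
      exact (show Continuous fun x : ℝ =>
        Complex.exp (-(2 * Real.pi * ξ * x : ℝ) * Complex.I) * φ (x + z) by
          fun_prop).aestronglyMeasurable
    · rw [norm_mul, hn, one_mul]
      exact norm_shift_le hr h hz x
  have hE : Differentiable ℂ fun w : ℂ => Complex.exp (2 * Real.pi * ξ * w * Complex.I) *
        ∫ x : ℝ, Complex.exp (-(2 * Real.pi * ξ * x : ℝ) * Complex.I) * φ x := by fun_prop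
  -- For real shifts the identity is translation invariance of the integral. Both sides are entire
  -- in `w`, so agreement at the points `1/(n+1)`, which accumulate at `0`, gives it everywhere.
  have hreal : ∀ t : ℝ,
      ∫ x : ℝ, Complex.exp (-(2 * Real.pi * ξ * x : ℝ) * Complex.I) * φ (x + (t : ℂ)) =
      Complex.exp (2 * Real.pi * ξ * (t : ℂ) * Complex.I) *
        ∫ x : ℝ, Complex.exp (-(2 * Real.pi * ξ * x : ℝ) * Complex.I) * φ x := by
    intro t
    rw [← integral_add_right_eq_self _ (-t), ← integral_const_mul]
    refine integral_congr_ae (Eventually.of_forall fun x => ?_)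
    simp only
    rw [← mul_assoc, ← Complex.exp_add]
    congr 2
    · push_cast
      ring
    · push_cast
      ring
  have key := AnalyticOnNhd.eq_of_frequently_eq
    (Complex.analyticOnNhd_univ_iff_differentiable.2 hJ)
    (Complex.analyticOnNhd_univ_iff_differentiable.2 hE)
    (z₀ := 0) ?_
  · exact congrFun key w
  · have hlim : Tendsto (fun n : ℕ => (((1 / ((n : ℝ) + 1) : ℝ)) : ℂ)) atTop (𝓝[≠] 0) := by
      refine tendsto_nhdsWithin_iff.2 ⟨?_, Eventually.of_forall fun n => ?_⟩
      · have := (Complex.continuous_ofReal.tendsto 0).comp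
          (tendsto_one_div_add_atTop_nhds_zero_nat (𝕜 := ℝ))
        simpa [Function.comp_def] using this
      · have : (1 / ((n : ℝ) + 1) : ℝ) ≠ 0 := by positivity
        exact Complex.ofReal_ne_zero.2 this
    exact hlim.frequently (Frequently.of_forall fun n => hreal _)

/-- Easy half of Paley–Wiener. Shifting the contour to height `y` multiplies the integral by
`e^(-2πξy)`, while the shifted integral is at most `A e^(r|y|)`. With `y` of sign opposite to `ξ`
and `|y| → ∞` the resulting bound tends to `0`. -/
theorem fourier_eq_zero_of_type_lt {r : ℝ} (hr : 0 ≤ r) {C : ℕ → ℝ} {φ : ℂ → ℂ}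
    (h : ExpTypeBound r C φ) (hd : Differentiable ℂ φ) {ξ : ℝ} (hξ : r < 2 * Real.pi * |ξ|) :
    𝓕 (fun x : ℝ => φ x) ξ = 0 := by
  have hJ0 : 𝓕 (fun x : ℝ => φ x) ξ =
      ∫ x : ℝ, Complex.exp (-(2 * Real.pi * ξ * x : ℝ) * Complex.I) * φ x := by
    rw [Real.fourier_real_eq_integral_exp_smul]
    refine integral_congr_ae (Eventually.of_forall fun x => ?_)
    simp only [smul_eq_mul]
    congr 2
    push_cast
    ring
  rw [hJ0]
  set J := ∫ x : ℝ, Complex.exp (-(2 * Real.pi * ξ * x : ℝ) * Complex.I) * φ x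
  set A := ∫ x : ℝ, C 2 * (1 + ‖x‖) ^ (-2 : ℝ)
  have hC := h.nonneg 2
  have hn : ∀ x : ℝ, ‖Complex.exp (-(2 * Real.pi * ξ * x : ℝ) * Complex.I)‖ = 1 := fun x => by
    rw [← Complex.ofReal_neg, Complex.norm_exp_ofReal_mul_I]
  have hbound : ∀ y : ℝ, ‖∫ x : ℝ, Complex.exp (-(2 * Real.pi * ξ * x : ℝ) * Complex.I) *
      φ (x + (y * Complex.I))‖ ≤ Real.exp (r * |y|) * A := by
    intro y
    rw [← integral_const_mul]
    refine norm_integral_le_of_norm_le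
      (((integrable_one_add_norm (E := ℝ) (r := 2) (by simp)).const_mul _).const_mul _)
      (Eventually.of_forall fun x => ?_)
    rw [norm_mul, hn, one_mul]
    have h1 := norm_le_div_sq h (x + y * Complex.I)
    have h2 : ‖x‖ ≤ ‖(x : ℂ) + y * Complex.I‖ := by
      have := Complex.abs_re_le_norm ((x : ℂ) + y * Complex.I)
      simpa using this
    have h3 : (1 + ‖(x : ℂ) + y * Complex.I‖) ^ (-2 : ℝ) ≤ (1 + ‖x‖) ^ (-2 : ℝ) :=
      Real.rpow_le_rpow_of_nonpos (by positivity) (by linarith) (by norm_num)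
    simp only [Complex.add_im, Complex.ofReal_im, Complex.mul_im, Complex.ofReal_re,
      Complex.I_im, mul_one, Complex.I_re, mul_zero, add_zero, zero_add] at h1
    calc _ ≤ _ := h1
      _ ≤ C 2 * Real.exp (r * |y|) * (1 + ‖x‖) ^ (-2 : ℝ) := by gcongr
      _ = _ := by ring
  have hexp : ∀ y : ℝ, ‖Complex.exp (2 * Real.pi * ξ * (y * Complex.I) * Complex.I)‖ =
      Real.exp (-(2 * Real.pi * ξ * y)) := by
    intro y
    rw [Complex.norm_exp]
    congr 1
    have : (2 * Real.pi * ξ * (y * Complex.I) * Complex.I : ℂ) =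
        ((-(2 * Real.pi * ξ * y) : ℝ) : ℂ) := by
      push_cast
      linear_combination (2 * Real.pi * ξ * y : ℂ) * Complex.I_mul_I
    rw [this, Complex.ofReal_re]
  have hineq : ∀ t : ℝ, 0 ≤ t → ‖J‖ ≤ A * Real.exp (-((2 * Real.pi * |ξ| - r) * t)) := by
    intro t ht
    obtain ⟨y, hy, hy'⟩ : ∃ y : ℝ, |y| = t ∧ -(ξ * y) = |ξ| * t := by
      rcases le_total 0 ξ with h0 | h0
      · exact ⟨-t, by rw [abs_neg, abs_of_nonneg ht], by rw [abs_of_nonneg h0]; ring⟩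
      · exact ⟨t, abs_of_nonneg ht, by rw [abs_of_nonpos h0]; ring⟩
    have h1 := hbound y
    rw [integral_shift_eq hr h hd, norm_mul, hexp, hy] at h1
    have h2 : -(2 * Real.pi * ξ * y) = 2 * Real.pi * |ξ| * t := by
      linear_combination 2 * Real.pi * hy'
    rw [h2] at h1
    have h3 : Real.exp (-((2 * Real.pi * |ξ| - r) * t)) =
        Real.exp (r * t) / Real.exp (2 * Real.pi * |ξ| * t) := by
      rw [← Real.exp_sub]
      congr 1
      ring
    rw [h3, ← mul_div_assoc, le_div_iff₀ (Real.exp_pos _)]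
    linarith
  have hlim : Tendsto (fun t : ℝ => A * Real.exp (-((2 * Real.pi * |ξ| - r) * t))) atTop
      (𝓝 (A * 0)) := by
    refine Tendsto.const_mul _ (Real.tendsto_exp_neg_atTop_nhds_zero.comp ?_)
    exact tendsto_id.const_mul_atTop (by linarith)
  rw [mul_zero] at hlim
  have := ge_of_tendsto hlim ((eventually_ge_atTop 0).mono hineq)
  exact norm_le_zero_iff.1 this

theorem SchwartzMap.rapidKernel (f : SchwartzMap ℝ ℂ) : RapidKernel f := by
  refine ⟨f.continuous.aestronglyMeasurable, fun κ => ?_⟩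
  have h1 := (SchwartzMap.integrable_pow_mul volume f κ).const_mul ((2 : ℝ) ^ κ)
  have h0 := (f.integrable (μ := volume)).norm.const_mul ((2 : ℝ) ^ κ)
  refine (h1.add h0).mono' ?_ (Eventually.of_forall fun s => ?_)
  · exact (Continuous.aestronglyMeasurable (by fun_prop)).mul
      f.continuous.norm.aestronglyMeasurable
  · rw [Real.norm_of_nonneg (by positivity)]
    simp only [Pi.add_apply, Real.norm_eq_abs]
    have h2 : (1 + |s|) ^ κ ≤ 2 ^ κ * |s| ^ κ + 2 ^ κ := by
      rcases le_total |s| 1 with h | h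
      · have : (1 + |s|) ^ κ ≤ 2 ^ κ := by
          gcongr
          linarith
        have : 0 ≤ 2 ^ κ * |s| ^ κ := by positivity
        linarith
      · have : (1 + |s|) ^ κ ≤ (2 * |s|) ^ κ := by
          gcongr
          linarith
        rw [mul_pow] at this
        have : (0 : ℝ) ≤ 2 ^ κ := by positivity
        linarith
    calc _ ≤ (2 ^ κ * |s| ^ κ + 2 ^ κ) * ‖f s‖ := by gcongr
      _ = _ := by ring

/-- A smooth symbol coincides on a bounded interval with the Fourier transform of a rapidly
decaying kernel. -/
theorem exists_rapidKernel_fourier_eq {m : ℝ → ℂ} (hm : ContDiff ℝ ∞ m) {R : ℝ} (hR : 0 < R) :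
    ∃ M : ℝ → ℂ, RapidKernel M ∧ ∀ ξ, |ξ| ≤ R → 𝓕 M ξ = m ξ := by
  -- The bump equals `1` on `[-R, R]`; the truncated symbol is Schwartz, and `M` is its inverse
  -- Fourier transform.
  let χ : ContDiffBump (0 : ℝ) := ⟨R, R + 1, hR, by linarith⟩
  have hχ : HasCompactSupport fun ξ : ℝ => χ ξ • m ξ := χ.hasCompactSupport.smul_right
  have hs : ContDiff ℝ ∞ fun ξ : ℝ => χ ξ • m ξ := χ.contDiff.smul hm
  refine ⟨(𝓕⁻ (hχ.toSchwartzMap hs) : SchwartzMap ℝ ℂ), SchwartzMap.rapidKernel _, fun ξ hξ => ?_⟩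
  rw [← SchwartzMap.fourier_coe, FourierTransform.fourier_fourierInv_eq]
  have : χ ξ = 1 := χ.one_of_mem_closedBall (by simpa using hξ)
  simp [this]

end

/-! ### Logarithmic variables and the gamma kernel -/

section

open FourierTransform ContDiff

theorem integrableOn_Ioi_zero_iff_exp (g : ℝ → ℂ) : IntegrableOn g (Set.Ioi 0) ↔
    Integrable fun x : ℝ => (Real.exp x : ℂ) * g (Real.exp x) := by
  have := integrableOn_image_iff_integrableOn_abs_deriv_smul MeasurableSet.univ
    (fun x _ => (Real.hasDerivAt_exp x).hasDerivWithinAt) Real.exp_injective.injOn g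
  simpa [Real.range_exp] using this

theorem integral_Ioi_zero_eq_exp (g : ℝ → ℂ) : ∫ t in Set.Ioi (0 : ℝ), g t =
    ∫ x : ℝ, (Real.exp x : ℂ) * g (Real.exp x) := by
  have := integral_image_eq_integral_abs_deriv_smul MeasurableSet.univ
    (fun x _ => (Real.hasDerivAt_exp x).hasDerivWithinAt) Real.exp_injective.injOn g
  simpa [Real.range_exp] using this

/-- The Laplace kernel `e^(-e^s) e^(γ s)` in logarithmic variables. -/
def gammaKernel (γ : ℝ) (s : ℝ) : ℂ := ((Real.exp (-Real.exp s) * Real.exp (γ * s) : ℝ) : ℂ)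

theorem exp_mul_cpow (x : ℝ) (s : ℂ) :
    (Real.exp x : ℂ) * ((Real.exp x : ℂ) ^ (s - 1)) = Complex.exp (s * x) := by
  have h : (Real.exp x : ℂ) ≠ 0 := Complex.ofReal_ne_zero.2 (Real.exp_pos x).ne'
  rw [Complex.cpow_def_of_ne_zero h, ← Complex.ofReal_log (Real.exp_pos x).le, Real.log_exp,
    Complex.ofReal_exp, ← Complex.exp_add]
  congr 1
  ring

theorem integrable_gammaKernel {γ : ℝ} (hγ : 0 < γ) : Integrable (gammaKernel γ) := by
  have h := (integrableOn_Ioi_zero_iff_exp _).1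
    (Complex.GammaIntegral_convergent (s := γ) (by simpa using hγ))
  refine h.congr (Eventually.of_forall fun x => ?_)
  simp only
  rw [mul_left_comm, exp_mul_cpow, gammaKernel]
  push_cast
  rfl

/-- Euler's integral for `Γ` after the substitution `t = e^x`. -/
theorem fourier_gammaKernel {γ : ℝ} (hγ : 0 < γ) (ξ : ℝ) :
    𝓕 (gammaKernel γ) ξ = Complex.Gamma (γ - 2 * Real.pi * ξ * Complex.I) := by
  rw [Complex.Gamma_eq_integral (by simpa using hγ), Complex.GammaIntegral,
    integral_Ioi_zero_eq_exp, Real.fourier_real_eq_integral_exp_smul]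
  refine integral_congr_ae (Eventually.of_forall fun x => ?_)
  simp only
  rw [mul_left_comm, exp_mul_cpow, gammaKernel, smul_eq_mul]
  push_cast
  rw [mul_left_comm, ← Complex.exp_add]
  congr 2
  ring

theorem continuous_gammaKernel (γ : ℝ) : Continuous (gammaKernel γ) := by
  unfold gammaKernel
  fun_prop

theorem norm_gammaKernel (γ s : ℝ) :
    ‖gammaKernel γ s‖ = Real.exp (-Real.exp s) * Real.exp (γ * s) := by
  rw [gammaKernel, Complex.norm_real, Real.norm_of_nonneg (by positivity)]

/-- Polynomial weights are dominated by `e^(γ s/2) + e^(-γ s/2)`, which only moves the parameter to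
`γ ± γ/2`, both positive. -/
theorem rapidKernel_gammaKernel {γ : ℝ} (hγ : 0 < γ) : RapidKernel (gammaKernel γ) := by
  refine ⟨(continuous_gammaKernel γ).aestronglyMeasurable, fun κ => ?_⟩
  obtain ⟨B, hB0, hB⟩ : ∃ B : ℝ, 0 ≤ B ∧
      ∀ x : ℝ, 0 ≤ x → (1 + x) ^ κ ≤ B * Real.exp (γ / 2 * x) := by
    -- The constant comes from `X^κ / κ! ≤ e^X` at `X = (γ/2)(1 + x)`.
    refine ⟨κ.factorial / (γ / 2) ^ κ * Real.exp (γ / 2), by positivity, fun x hx => ?_⟩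
    have h1 := Real.pow_div_factorial_le_exp (γ / 2 * (1 + x)) (by positivity) κ
    rw [mul_pow, div_le_iff₀ (by positivity), ← le_div_iff₀' (by positivity)] at h1
    refine h1.trans (le_of_eq ?_)
    rw [mul_add, mul_one, Real.exp_add]
    ring
  have hi := ((integrable_gammaKernel (γ := γ + γ / 2) (by positivity)).norm.add
    (integrable_gammaKernel (γ := γ - γ / 2) (by linarith)).norm).const_mul B
  refine hi.mono' (Continuous.aestronglyMeasurable ?_) (Eventually.of_forall fun s => ?_)
  · exact ((continuous_const.add continuous_abs).pow κ).mul (continuous_gammaKernel γ).norm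
  · rw [Real.norm_of_nonneg (by positivity)]
    simp only [Pi.add_apply, norm_gammaKernel]
    have h1 : Real.exp (γ / 2 * |s|) ≤ Real.exp (γ / 2 * s) + Real.exp (-(γ / 2 * s)) := by
      rcases abs_cases s with ⟨h, _⟩ | ⟨h, _⟩ <;> rw [h]
      · linarith [Real.exp_pos (-(γ / 2 * s))]
      · rw [mul_neg]
        linarith [Real.exp_pos (γ / 2 * s)]
    calc (1 + |s|) ^ κ * (Real.exp (-Real.exp s) * Real.exp (γ * s))
        ≤ (B * (Real.exp (γ / 2 * s) + Real.exp (-(γ / 2 * s)))) *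
          (Real.exp (-Real.exp s) * Real.exp (γ * s)) := by
          gcongr
          exact (hB _ (abs_nonneg s)).trans (by gcongr)
      _ = _ := by
        rw [show (γ + γ / 2) * s = γ * s + γ / 2 * s by ring,
          show (γ - γ / 2) * s = γ * s + -(γ / 2 * s) by ring, Real.exp_add, Real.exp_add]
        ring

/-! ### Inverting the gamma correlation at fixed exponential type -/

theorem continuous_of_mem_spaceZ {u : ℝ → ℂ} (hu : u ∈ spaceZ) : Continuous u := by
  obtain ⟨φ, hφ, -⟩ := hu
  have : u = fun x : ℝ => φ x := funext fun x => (hφ.2 x).symm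
  rw [this]
  exact hφ.1.continuous.comp Complex.continuous_ofReal

theorem integrable_of_mem_spaceZ {u : ℝ → ℂ} (hu : u ∈ spaceZ) : Integrable u := by
  obtain ⟨φ, hφ, r, hr, C, hC⟩ := hu
  have : u = fun x : ℝ => φ x := funext fun x => (hφ.2 x).symm
  rw [this]
  exact hC.integrable hφ.1

theorem exists_bound_of_mem_spaceZ {u : ℝ → ℂ} (hu : u ∈ spaceZ) : ∃ B, ∀ x, ‖u x‖ ≤ B := by
  obtain ⟨φ, hφ, r, hr, C, hC⟩ := hu
  exact ⟨C 0, fun x => by rw [← hφ.2]; exact hC.norm_real_le x⟩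

/-- On functions of bounded exponential type the correlation with the gamma kernel is inverted by
the correlation with a rapidly decaying kernel. -/
theorem exists_inverse_kernel {γ : ℝ} (hγ : 0 < γ) {r : ℝ} (hr : 0 < r) :
    ∃ M : ℝ → ℂ, RapidKernel M ∧ ∀ (u : ℝ → ℂ) (φ : ℂ → ℂ) (C : ℕ → ℝ), IsEntireExt u φ →
      ExpTypeBound r C φ → corrLine M (corrLine (gammaKernel γ) u) = u ∧
        corrLine (gammaKernel γ) (corrLine M u) = u := by
  -- The sign is `+` because two successive correlations give the symbol `𝓕 M ξ * 𝓕 K (-ξ)`.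
  have hm : ContDiff ℝ ∞ fun ξ : ℝ => (Complex.Gamma (γ + 2 * Real.pi * ξ * Complex.I))⁻¹ := by
    have h1 : ContDiff ℂ ∞ fun s : ℂ => (Complex.Gamma s)⁻¹ :=
      Complex.differentiable_one_div_Gamma.contDiff
    refine (h1.restrict_scalars ℝ).comp (f := fun ξ : ℝ => (γ + 2 * Real.pi * ξ * Complex.I : ℂ))
      ?_
    have : ContDiff ℝ ∞ fun ξ : ℝ => (ξ : ℂ) := Complex.ofRealCLM.contDiff
    fun_prop
  obtain ⟨M, hM, hMm⟩ := exists_rapidKernel_fourier_eq hm hr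
  have hK := rapidKernel_gammaKernel hγ
  have hne : ∀ ξ : ℝ, Complex.Gamma (γ + 2 * Real.pi * ξ * Complex.I) ≠ 0 := fun ξ =>
    Complex.Gamma_ne_zero_of_re_pos (by simpa using hγ)
  refine ⟨M, hM, fun u φ C hu hC => ?_⟩
  have huZ : u ∈ spaceZ := ⟨φ, hu, r, hr, C, hC⟩
  have hui := integrable_of_mem_spaceZ huZ
  -- The sharp threshold is `r / (2π)`; the cruder `r` suffices and is where the symbol of `M` was
  -- prescribed.
  have hzero : ∀ ξ : ℝ, r < |ξ| → 𝓕 u ξ = 0 := fun ξ hξ => by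
    have h1 : u = fun x : ℝ => φ x := funext fun x => (hu.2 x).symm
    rw [h1]
    refine fourier_eq_zero_of_type_lt hr.le hC hu.1 (hξ.trans_le ?_)
    nlinarith [Real.pi_gt_three, abs_nonneg ξ]
  constructor
  · have hw := corrLine_mem_spaceZ hK huZ
    have hw' := corrLine_mem_spaceZ hM hw
    refine eq_of_fourier_eq (continuous_of_mem_spaceZ hw') (continuous_of_mem_spaceZ huZ)
      (integrable_of_mem_spaceZ hw') hui (funext fun ξ => ?_)
    rw [fourier_corrLine hM.integrable (integrable_of_mem_spaceZ hw),
      fourier_corrLine hK.integrable hui, neg_neg]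
    by_cases h : |ξ| ≤ r
    · rw [hMm ξ h, fourier_gammaKernel hγ]
      have := hne ξ
      push_cast
      rw [mul_neg, neg_mul, sub_neg_eq_add, inv_mul_cancel_left₀ this]
    · rw [hzero ξ (not_le.1 h), mul_zero, mul_zero]
  · have hw := corrLine_mem_spaceZ hM huZ
    have hw' := corrLine_mem_spaceZ hK hw
    refine eq_of_fourier_eq (continuous_of_mem_spaceZ hw') (continuous_of_mem_spaceZ huZ)
      (integrable_of_mem_spaceZ hw') hui (funext fun ξ => ?_)
    rw [fourier_corrLine hK.integrable (integrable_of_mem_spaceZ hw),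
      fourier_corrLine hM.integrable hui, neg_neg]
    by_cases h : |ξ| ≤ r
    · rw [hMm (-ξ) (by rwa [abs_neg]), fourier_gammaKernel hγ]
      have := hne (-ξ)
      push_cast at this ⊢
      rw [mul_neg, neg_mul, ← sub_eq_add_neg] at this ⊢
      rw [mul_inv_cancel_left₀ this]
    · rw [hzero ξ (not_le.1 h), mul_zero, mul_zero]

/-! ### The Laplace transform on the half-line -/

theorem zeroExt_of_pos (f : RPos → ℂ) {t : ℝ} (ht : 0 < t) : zeroExt f t = f ⟨t, ht⟩ := dif_pos ht

theorem zeroExt_exp (f : RPos → ℂ) (x : ℝ) : zeroExt f (Real.exp x) = f (expPos x) :=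
  zeroExt_of_pos f (Real.exp_pos x)

theorem expPos_log (t : RPos) : expPos (Real.log t) = t := Subtype.ext (Real.exp_log t.2)

theorem apply_expPos (γ : ℝ) (f : RPos → ℂ) (x : ℝ) :
    f (expPos x) = (Real.exp (-((1 / 2 - γ) * x)) : ℂ) * toLine γ f x := by
  simp only [toLine, LinearMap.coe_mk, AddHom.coe_mk]
  rw [← mul_assoc, ← Complex.ofReal_mul, ← Real.exp_add]
  simp

theorem toLine_injective (γ : ℝ) : Function.Injective (toLine γ) := by
  intro f g h
  ext t
  rw [← expPos_log t, apply_expPos γ f, apply_expPos γ g, h]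

/-- The inverse of `toLine`. -/
def ofLine (γ : ℝ) (u : ℝ → ℂ) (t : RPos) : ℂ :=
  (Real.exp (-((1 / 2 - γ) * Real.log t)) : ℂ) * u (Real.log t)

theorem toLine_ofLine (γ : ℝ) (u : ℝ → ℂ) : toLine γ (ofLine γ u) = u := by
  ext x
  simp only [toLine, LinearMap.coe_mk, AddHom.coe_mk, ofLine, expPos, Real.log_exp]
  rw [← mul_assoc, ← Complex.ofReal_mul, ← Real.exp_add]
  simp

/-- With `u` the line function of `f`, `f(e^x) = e^((γ-1)x) u(x)`. The Jacobian `e^x` raises this to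
`e^(γx) = e^(-γy) e^(γ(x+y))`, and the last factor belongs to the kernel. -/
theorem exp_mul_laplaceIntegrand (γ : ℝ) (f : RPos → ℂ) (x y : ℝ) :
    (Real.exp x : ℂ) * laplaceIntegrand f (expPos y) (Real.exp x) =
      (Real.exp (-(γ * y)) : ℂ) * (gammaKernel γ (x + y) * toLine (γ - 1 / 2) f x) := by
  rw [laplaceIntegrand, zeroExt_exp, apply_expPos (γ - 1 / 2) f]
  simp only [gammaKernel, expPos, Real.exp_add x y]
  have : Real.exp (-(γ * y)) * Real.exp (γ * (x + y)) =
      Real.exp x * Real.exp (-((1 / 2 - (γ - 1 / 2)) * x)) := by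
    rw [← Real.exp_add, ← Real.exp_add]
    congr 1
    ring
  have h2 := congrArg (fun a : ℝ => (a : ℂ)) this
  simp only [Complex.ofReal_mul] at h2 ⊢
  linear_combination (-(Real.exp (-(Real.exp x * Real.exp y)) : ℂ) *
    toLine (γ - 1 / 2) f x) * h2

theorem integrableOn_laplaceIntegrand {γ : ℝ} (hγ : 0 < γ) {f : RPos → ℂ}
    (hf : f ∈ spaceZg (γ - 1 / 2)) (lam : RPos) :
    IntegrableOn (laplaceIntegrand f lam) (Set.Ioi (0 : ℝ)) := by
  rw [integrableOn_Ioi_zero_iff_exp, ← expPos_log lam]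
  simp only [exp_mul_laplaceIntegrand γ]
  obtain ⟨B, hB⟩ := exists_bound_of_mem_spaceZ hf
  exact (((integrable_gammaKernel hγ).comp_add_right _).mul_bdd
    (continuous_of_mem_spaceZ hf).aestronglyMeasurable (Eventually.of_forall hB)).const_mul _

/-- The weight `e^(γy)` in `toLine (1 / 2 - γ)` cancels the factor `e^(-γy)` left over from the
integrand. -/
theorem toLine_laplace (γ : ℝ) (f : RPos → ℂ) :
    toLine (1 / 2 - γ) (laplace f) = corrLine (gammaKernel γ) (toLine (γ - 1 / 2) f) := by
  ext y
  have h1 : corrLine (gammaKernel γ) (toLine (γ - 1 / 2) f) y =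
      ∫ x : ℝ, gammaKernel γ (x + y) * toLine (γ - 1 / 2) f x := by
    rw [corrLine, ← integral_add_right_eq_self _ y]
    simp
  rw [h1]
  show (Real.exp ((1 / 2 - (1 / 2 - γ)) * y) : ℂ) * laplace f (expPos y) = _
  rw [laplace, integral_Ioi_zero_eq_exp]
  simp only [exp_mul_laplaceIntegrand γ]
  rw [integral_const_mul, ← mul_assoc, ← Complex.ofReal_mul, ← Real.exp_add]
  simp

theorem laplace_mem {γ : ℝ} (hγ : 0 < γ) {f : RPos → ℂ} (hf : f ∈ spaceZg (γ - 1 / 2)) :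
    laplace f ∈ spaceZg (1 / 2 - γ) := by
  show toLine _ _ ∈ spaceZ
  rw [toLine_laplace]
  exact corrLine_mem_spaceZ (rapidKernel_gammaKernel hγ) hf

/-- The Laplace transform as a linear map. -/
def laplaceMap {γ : ℝ} (hγ : 0 < γ) : spaceZg (γ - 1 / 2) →ₗ[ℂ] spaceZg (1 / 2 - γ) where
  toFun f := ⟨laplace f, laplace_mem hγ f.2⟩
  map_add' f g := by
    ext lam
    have h1 := integrableOn_laplaceIntegrand hγ f.2 lam
    have h2 := integrableOn_laplaceIntegrand hγ g.2 lam
    show laplace (f + g : RPos → ℂ) lam = laplace f lam + laplace g lam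
    rw [laplace, laplace, laplace, ← integral_add h1 h2]
    refine setIntegral_congr_fun measurableSet_Ioi fun t (ht : 0 < t) => ?_
    simp only [laplaceIntegrand, zeroExt_of_pos _ ht, Pi.add_apply, mul_add]
  map_smul' c f := by
    ext lam
    show laplace (c • f : RPos → ℂ) lam = c * laplace f lam
    rw [laplace, laplace, ← integral_const_mul]
    refine setIntegral_congr_fun measurableSet_Ioi fun t (ht : 0 < t) => ?_
    simp only [laplaceIntegrand, zeroExt_of_pos _ ht, Pi.smul_apply, smul_eq_mul, mul_left_comm]

theorem laplaceMap_injective {γ : ℝ} (hγ : 0 < γ) : Function.Injective (laplaceMap hγ) := by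
  rw [injective_iff_map_eq_zero]
  intro f hf
  obtain ⟨φ, hφ, r, hr, C, hC⟩ := f.2
  obtain ⟨M, hM, hinv⟩ := exists_inverse_kernel hγ hr
  have h1 : laplace f = 0 := congrArg Subtype.val hf
  have h2 := toLine_laplace γ f
  rw [h1, map_zero] at h2
  have h3 := (hinv _ φ C hφ hC).1
  rw [← h2] at h3
  refine Subtype.ext (toLine_injective (γ - 1 / 2) ?_)
  rw [← h3]
  ext y
  simp [corrLine]

theorem laplaceMap_ofLine {γ : ℝ} (hγ : 0 < γ) {M : ℝ → ℂ}
    {g : spaceZg (1 / 2 - γ)} {f : spaceZg (γ - 1 / 2)}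
    (hf : toLine (γ - 1 / 2) f = corrLine M (toLine (1 / 2 - γ) g))
    (hinv : corrLine (gammaKernel γ) (corrLine M (toLine (1 / 2 - γ) g)) =
      toLine (1 / 2 - γ) g) : laplaceMap hγ f = g := by
  refine Subtype.ext (toLine_injective (1 / 2 - γ) ?_)
  show toLine (1 / 2 - γ) (laplace f) = _
  rw [toLine_laplace, hf, hinv]

theorem laplaceMap_surjective {γ : ℝ} (hγ : 0 < γ) : Function.Surjective (laplaceMap hγ) := by
  intro g
  obtain ⟨φ, hφ, r, hr, C, hC⟩ := g.2
  obtain ⟨M, hM, hinv⟩ := exists_inverse_kernel hγ hr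
  refine ⟨⟨ofLine (γ - 1 / 2) (corrLine M (toLine (1 / 2 - γ) g)), ?_⟩,
    laplaceMap_ofLine hγ (M := M) (toLine_ofLine _ _) (hinv _ φ C hφ hC).2⟩
  show toLine _ _ ∈ spaceZ
  rw [toLine_ofLine]
  exact corrLine_mem_spaceZ hM g.2

/-- The Laplace transform as a linear bijection. -/
def laplaceEquiv {γ : ℝ} (hγ : 0 < γ) : spaceZg (γ - 1 / 2) ≃ₗ[ℂ] spaceZg (1 / 2 - γ) :=
  LinearEquiv.ofBijective (laplaceMap hγ) ⟨laplaceMap_injective hγ, laplaceMap_surjective hγ⟩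

theorem coe_laplaceEquiv {γ : ℝ} (hγ : 0 < γ) (f : spaceZg (γ - 1 / 2)) :
    (laplaceEquiv hγ f : RPos → ℂ) = laplace f := rfl

theorem tendstoZero_laplaceEquiv {γ : ℝ} (hγ : 0 < γ) {f : ℕ → spaceZg (γ - 1 / 2)}
    (hf : TendstoZero f) : TendstoZero fun k => laplaceEquiv hγ (f k) := by
  have := TendstoZeroZ.corrLine (rapidKernel_gammaKernel hγ) hf
  simpa only [TendstoZero, coe_laplaceEquiv, toLine_laplace] using this

theorem tendstoZero_laplaceEquiv_symm {γ : ℝ} (hγ : 0 < γ) {g : ℕ → spaceZg (1 / 2 - γ)}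
    (hg : TendstoZero g) : TendstoZero fun k => (laplaceEquiv hγ).symm (g k) := by
  -- The type `r` is common to the whole sequence, so a single kernel `M` inverts every term.
  obtain ⟨φ, hφ, ⟨r, hr, C, hC⟩, -⟩ := id hg
  obtain ⟨M, hM, hinv⟩ := exists_inverse_kernel hγ hr
  have h := TendstoZeroZ.corrLine hM hg
  have key : ∀ k, toLine (γ - 1 / 2) ((laplaceEquiv hγ).symm (g k)) =
      corrLine M (toLine (1 / 2 - γ) (g k)) := by
    intro k
    let f : spaceZg (γ - 1 / 2) := ⟨ofLine (γ - 1 / 2) (corrLine M (toLine (1 / 2 - γ) (g k))), by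
      show toLine _ _ ∈ spaceZ
      rw [toLine_ofLine]
      exact corrLine_mem_spaceZ hM (g k).2⟩
    have hf : toLine (γ - 1 / 2) f = corrLine M (toLine (1 / 2 - γ) (g k)) := toLine_ofLine _ _
    have h1 : laplaceEquiv hγ f = g k := laplaceMap_ofLine hγ hf (hinv _ _ C (hφ k) (hC k)).2
    rw [← h1, LinearEquiv.symm_apply_apply, h1, hf]
  simpa only [TendstoZero, key] using h

end

/-! ### Products and the Laplace convolution -/

theorem mul_mem_spaceZ {u v : ℝ → ℂ} (hu : u ∈ spaceZ) (hv : v ∈ spaceZ) : u * v ∈ spaceZ := by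
  obtain ⟨φ, hφ, r, hr, C, hC⟩ := hu
  obtain ⟨ψ, hψ, s, hs, D, hD⟩ := hv
  refine ⟨φ * ψ, ⟨hφ.1.mul hψ.1, fun x => by simp [hφ.2, hψ.2]⟩, r + s, by positivity,
    fun κ => C κ * D 0, fun κ z => ?_⟩
  have h1 := hC κ z
  have h2 := hD.norm_le z
  have h3 := hC.nonneg κ
  rw [Pi.mul_apply, norm_mul, add_mul, Real.exp_add]
  calc (1 + ‖z‖) ^ κ * (‖φ z‖ * ‖ψ z‖) = ((1 + ‖z‖) ^ κ * ‖φ z‖) * ‖ψ z‖ := by ring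
    _ ≤ (C κ * Real.exp (r * |z.im|)) * (D 0 * Real.exp (s * |z.im|)) := by gcongr
    _ = _ := by ring

theorem IsEntireExt.conj {u : ℝ → ℂ} {φ : ℂ → ℂ} (h : IsEntireExt u φ) :
    IsEntireExt (fun x => starRingEnd ℂ (u x))
      (fun z => starRingEnd ℂ (φ (starRingEnd ℂ z))) :=
  ⟨fun z => by simpa [Function.comp_def] using (h.1 (starRingEnd ℂ z)).conj_conj,
    fun x => by simp [h.2]⟩

theorem ExpTypeBound.conj {r : ℝ} {C : ℕ → ℝ} {φ : ℂ → ℂ} (h : ExpTypeBound r C φ) :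
    ExpTypeBound r C (fun z => starRingEnd ℂ (φ (starRingEnd ℂ z))) := fun κ z => by
  simpa using h κ (starRingEnd ℂ z)

theorem conj_mem_spaceZ {u : ℝ → ℂ} (hu : u ∈ spaceZ) :
    (fun x => starRingEnd ℂ (u x)) ∈ spaceZ := by
  obtain ⟨φ, hφ, r, hr, C, hC⟩ := hu
  exact ⟨_, hφ.conj, r, hr, C, hC.conj⟩

/-- The weights `e^(γy/2)` of the two factors multiply to the weight `e^(γy)` of the product. -/
theorem conjMul_mem {γ : ℝ} {g₁ g₂ : RPos → ℂ} (h₁ : g₁ ∈ spaceZg (1 / 2 - γ / 2))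
    (h₂ : g₂ ∈ spaceZg (1 / 2 - γ / 2)) : conjMul g₁ g₂ ∈ spaceZg (1 / 2 - γ) := by
  have h : toLine (1 / 2 - γ) (conjMul g₁ g₂) =
      (fun x => starRingEnd ℂ (toLine (1 / 2 - γ / 2) g₁ x)) * toLine (1 / 2 - γ / 2) g₂ := by
    ext y
    have h1 : Real.exp ((1 / 2 - (1 / 2 - γ)) * y) = Real.exp ((1 / 2 - (1 / 2 - γ / 2)) * y) *
        Real.exp ((1 / 2 - (1 / 2 - γ / 2)) * y) := by
      rw [← Real.exp_add]
      congr 1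
      ring
    simp only [toLine, LinearMap.coe_mk, AddHom.coe_mk, conjMul, Pi.mul_apply, map_mul,
      Complex.conj_ofReal, h1, Complex.ofReal_mul]
    ring
  show toLine _ _ ∈ spaceZ
  rw [h]
  exact mul_mem_spaceZ (conj_mem_spaceZ h₁) h₂

/-- The integrand of the Laplace convolution in logarithmic variables. -/
def betaIntegrand (a : ℝ) (φ ψ : ℂ → ℂ) (z : ℂ) (v : ℝ) : ℂ :=
  ((v ^ (a - 1) * (1 - v) ^ (a - 1) : ℝ) : ℂ) *
    (φ (z + (Real.log v : ℂ)) * ψ (z + (Real.log (1 - v) : ℂ)))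

theorem integrableOn_betaWeight {a : ℝ} (ha : 0 < a) :
    IntegrableOn (fun v : ℝ => v ^ (a - 1) * (1 - v) ^ (a - 1)) (Set.Ioo 0 1) := by
  have h := (Complex.betaIntegral_convergent (u := a) (v := a) (by simpa using ha)
    (by simpa using ha)).norm
  rw [intervalIntegrable_iff_integrableOn_Ioo_of_le zero_le_one] at h
  refine h.congr_fun (fun v hv => ?_) measurableSet_Ioo
  have h1 : (0 : ℝ) < 1 - v := sub_pos.2 hv.2
  have h2 : (1 - v : ℂ) = ((1 - v : ℝ) : ℂ) := by push_cast; rfl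
  simp only [norm_mul]
  rw [h2, Complex.norm_cpow_eq_rpow_re_of_pos hv.1, Complex.norm_cpow_eq_rpow_re_of_pos h1]
  simp

/-- One of `v`, `1 - v` is at least `1/2`, so its logarithm is at most `1` in absolute value and the
corresponding factor carries the decay in `z`, at the cost of `2^κ`. The other factor is only
bounded. Both shifts are real, hence the types simply add. -/
theorem betaIntegrand_bound {a : ℝ} {φ ψ : ℂ → ℂ} {r s : ℝ} {C D : ℕ → ℝ}
    (hφ : ExpTypeBound r C φ) (hψ : ExpTypeBound s D ψ) (κ : ℕ) (z : ℂ) {v : ℝ}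
    (hv : v ∈ Set.Ioo (0 : ℝ) 1) :
    (1 + ‖z‖) ^ κ * ‖betaIntegrand a φ ψ z v‖ ≤ (v ^ (a - 1) * (1 - v) ^ (a - 1)) *
      (2 ^ κ * (C κ * D 0 + C 0 * D κ) * Real.exp ((r + s) * |z.im|)) := by
  have hv1 : (0 : ℝ) < 1 - v := sub_pos.2 hv.2
  have hw : 0 ≤ v ^ (a - 1) * (1 - v) ^ (a - 1) :=
    mul_nonneg (Real.rpow_nonneg hv.1.le _) (Real.rpow_nonneg hv1.le _)
  have hhalf : ∀ t : ℝ, 1 / 2 ≤ t → t < 1 →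
      (1 + ‖z‖) ^ κ ≤ 2 ^ κ * (1 + ‖z + (Real.log t : ℂ)‖) ^ κ := by
    intro t h1 h2
    have h3 : |Real.log t| ≤ 1 := by
      have h4 : Real.log t ≤ 0 := Real.log_nonpos (by linarith) h2.le
      have h5 : Real.log (1 / 2) ≤ Real.log t := Real.log_le_log (by norm_num) h1
      have h6 := Real.log_two_lt_d9
      rw [one_div, Real.log_inv] at h5
      rw [abs_le]
      constructor <;> linarith
    have h4 : ‖z‖ ≤ ‖z + (Real.log t : ℂ)‖ + 1 := by
      have := norm_sub_le (z + (Real.log t : ℂ)) (Real.log t : ℂ)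
      rw [add_sub_cancel_right, Complex.norm_real, Real.norm_eq_abs] at this
      linarith
    rw [← mul_pow]
    have := norm_nonneg (z + (Real.log t : ℂ))
    gcongr
    linarith
  set x := z + (Real.log v : ℂ)
  set y := z + (Real.log (1 - v) : ℂ)
  have hx : x.im = z.im := by simp [x]
  have hy : y.im = z.im := by simp [y]
  have hφ0 := hφ.norm_le x
  have hψ0 := hψ.norm_le y
  have hφκ := hφ κ x
  have hψκ := hψ κ y
  rw [hx] at hφ0 hφκ
  rw [hy] at hψ0 hψκ
  have hC0 := hφ.nonneg 0
  have hCκ := hφ.nonneg κ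
  have hD0 := hψ.nonneg 0
  have hDκ := hψ.nonneg κ
  have key : (1 + ‖z‖) ^ κ * (‖φ x‖ * ‖ψ y‖) ≤
      2 ^ κ * (C κ * D 0 + C 0 * D κ) * Real.exp ((r + s) * |z.im|) := by
    rw [add_mul r, Real.exp_add]
    set E := Real.exp (r * |z.im|)
    set F := Real.exp (s * |z.im|)
    have hE : 0 ≤ E := (Real.exp_pos _).le
    have hF : 0 ≤ F := (Real.exp_pos _).le
    rcases le_total (1 / 2) v with h | h
    · calc (1 + ‖z‖) ^ κ * (‖φ x‖ * ‖ψ y‖)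
          ≤ (2 ^ κ * (1 + ‖x‖) ^ κ) * (‖φ x‖ * ‖ψ y‖) := by
            gcongr
            exact hhalf v h hv.2
        _ = 2 ^ κ * (((1 + ‖x‖) ^ κ * ‖φ x‖) * ‖ψ y‖) := by ring
        _ ≤ 2 ^ κ * ((C κ * E) * (D 0 * F)) := by gcongr
        _ ≤ 2 ^ κ * ((C κ * E) * (D 0 * F)) + 2 ^ κ * ((C 0 * E) * (D κ * F)) :=
            le_add_of_nonneg_right (by positivity)
        _ = _ := by ring
    · calc (1 + ‖z‖) ^ κ * (‖φ x‖ * ‖ψ y‖)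
          ≤ (2 ^ κ * (1 + ‖y‖) ^ κ) * (‖φ x‖ * ‖ψ y‖) := by
            gcongr
            exact hhalf (1 - v) (by linarith) (by linarith [hv.1])
        _ = 2 ^ κ * (‖φ x‖ * ((1 + ‖y‖) ^ κ * ‖ψ y‖)) := by ring
        _ ≤ 2 ^ κ * ((C 0 * E) * (D κ * F)) := by gcongr
        _ ≤ 2 ^ κ * ((C 0 * E) * (D κ * F)) + 2 ^ κ * ((C κ * E) * (D 0 * F)) :=
            le_add_of_nonneg_right (by positivity)
        _ = _ := by ring
  rw [betaIntegrand, norm_mul, norm_mul, Complex.norm_real, Real.norm_of_nonneg hw, mul_left_comm]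
  exact mul_le_mul_of_nonneg_left key hw

theorem aestronglyMeasurable_betaIntegrand (a : ℝ) {φ ψ : ℂ → ℂ} (hφ : Continuous φ)
    (hψ : Continuous ψ) (z : ℂ) (μ : Measure ℝ) :
    AEStronglyMeasurable (betaIntegrand a φ ψ z) μ := by
  have h1 := hφ.measurable
  have h2 := hψ.measurable
  have : Measurable (betaIntegrand a φ ψ z) := by
    unfold betaIntegrand
    fun_prop
  exact this.aestronglyMeasurable

theorem integrableOn_betaIntegrand {a : ℝ} (ha : 0 < a) {φ ψ : ℂ → ℂ} {r s : ℝ} {C D : ℕ → ℝ}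
    (hφ : ExpTypeBound r C φ) (hψ : ExpTypeBound s D ψ) (hφc : Continuous φ) (hψc : Continuous ψ)
    (z : ℂ) : IntegrableOn (betaIntegrand a φ ψ z) (Set.Ioo 0 1) := by
  refine ((integrableOn_betaWeight ha).mul_const
    (2 ^ 0 * (C 0 * D 0 + C 0 * D 0) * Real.exp ((r + s) * |z.im|))).mono'
    (aestronglyMeasurable_betaIntegrand a hφc hψc z _)
    ((ae_restrict_iff' measurableSet_Ioo).2 (Eventually.of_forall fun v hv => ?_))
  simpa using betaIntegrand_bound hφ hψ 0 z hv

theorem betaIntegral_bound {a : ℝ} (ha : 0 < a) {φ ψ : ℂ → ℂ} {r s : ℝ} {C D : ℕ → ℝ}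
    (hφ : ExpTypeBound r C φ) (hψ : ExpTypeBound s D ψ) :
    ExpTypeBound (r + s) (fun κ => (∫ v in Set.Ioo (0 : ℝ) 1, v ^ (a - 1) * (1 - v) ^ (a - 1)) *
      (2 ^ κ * (C κ * D 0 + C 0 * D κ)))
      (fun z => ∫ v in Set.Ioo (0 : ℝ) 1, betaIntegrand a φ ψ z v) := by
  intro κ z
  rw [mul_assoc, ← integral_mul_const]
  have hz : (0 : ℝ) ≤ (1 + ‖z‖) ^ κ := by positivity
  rw [← Real.norm_of_nonneg hz, ← norm_smul, ← integral_smul]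
  refine norm_integral_le_of_norm_le ((integrableOn_betaWeight ha).mul_const _)
    ((ae_restrict_iff' measurableSet_Ioo).2 (Eventually.of_forall fun v hv => ?_))
  rw [norm_smul, Real.norm_of_nonneg hz]
  exact betaIntegrand_bound hφ hψ κ z hv

theorem differentiable_betaIntegral {a : ℝ} (ha : 0 < a) {φ ψ : ℂ → ℂ} {r s : ℝ} {C D : ℕ → ℝ}
    (hr : 0 ≤ r) (hs : 0 ≤ s) (hφ : ExpTypeBound r C φ) (hψ : ExpTypeBound s D ψ)
    (hφd : Differentiable ℂ φ) (hψd : Differentiable ℂ ψ) :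
    Differentiable ℂ fun z => ∫ v in Set.Ioo (0 : ℝ) 1, betaIntegrand a φ ψ z v := by
  refine differentiable_integral_of_dominated
    (fun z => aestronglyMeasurable_betaIntegrand a hφd.continuous hψd.continuous z _)
    (fun v => ?_) fun R => ⟨_, (integrableOn_betaWeight ha).mul_const
      (2 ^ 0 * (C 0 * D 0 + C 0 * D 0) * Real.exp ((r + s) * R)),
      (ae_restrict_iff' measurableSet_Ioo).2 (Eventually.of_forall fun v hv z hz => ?_)⟩
  · unfold betaIntegrand
    exact ((hφd.comp (differentiable_id.add_const _)).mul
      (hψd.comp (differentiable_id.add_const _))).const_mul _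
  · have h1 := betaIntegrand_bound (a := a) hφ hψ 0 z hv
    rw [pow_zero, one_mul] at h1
    have hw : 0 ≤ v ^ (a - 1) * (1 - v) ^ (a - 1) :=
      mul_nonneg (Real.rpow_nonneg hv.1.le _) (Real.rpow_nonneg (sub_pos.2 hv.2).le _)
    have hC0 := hφ.nonneg 0
    have hD0 := hψ.nonneg 0
    refine h1.trans (mul_le_mul_of_nonneg_left ?_ hw)
    gcongr
    exact (Complex.abs_im_le_norm z).trans hz

theorem zeroExt_mul_exp (γ : ℝ) (f : RPos → ℂ) (x : ℝ) {v : ℝ} (hv : 0 < v) :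
    zeroExt f (Real.exp x * v) = (Real.exp (-((1 / 2 - γ) * (x + Real.log v))) : ℂ) *
      toLine γ f (x + Real.log v) := by
  rw [← apply_expPos γ f, ← zeroExt_exp f, Real.exp_add, Real.exp_log hv]

/-- Substituting `s = e^x v`, each factor has the form `t^(γ/2 - 1) F(log t)`, with `t = e^x v` and
`t = e^x (1 - v)`; the powers of `v` and `1 - v` form a beta weight with both parameters `γ/2`. -/
theorem convIntegrand_mul_exp (γ : ℝ) {f₁ f₂ : RPos → ℂ} {φ ψ : ℂ → ℂ}
    (hφ : IsEntireExt (toLine ((γ - 1) / 2) f₁) φ) (hψ : IsEntireExt (toLine ((γ - 1) / 2) f₂) ψ)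
    (x : ℝ) {v : ℝ} (hv : v ∈ Set.Ioo (0 : ℝ) 1) :
    convIntegrand f₁ f₂ (expPos x) (Real.exp x * v) = (Real.exp ((γ - 2) * x) : ℂ) *
      betaIntegrand (γ / 2) (fun z => starRingEnd ℂ (φ (starRingEnd ℂ z))) ψ x v := by
  have hv1 : (0 : ℝ) < 1 - v := sub_pos.2 hv.2
  have h1 : ((expPos x : RPos) : ℝ) - Real.exp x * v = Real.exp x * (1 - v) := by
    simp only [expPos]
    ring
  have h2 : ∀ t : ℝ, 0 < t → Real.exp (-((1 / 2 - (γ - 1) / 2) * (x + Real.log t))) =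
      Real.exp ((γ / 2 - 1) * x) * t ^ (γ / 2 - 1) := fun t ht => by
    rw [Real.rpow_def_of_pos ht, ← Real.exp_add]
    congr 1
    ring
  have h3 : Real.exp ((γ - 2) * x) = Real.exp ((γ / 2 - 1) * x) * Real.exp ((γ / 2 - 1) * x) := by
    rw [← Real.exp_add]
    congr 1
    ring
  rw [convIntegrand, h1, zeroExt_mul_exp _ f₁ x hv.1, zeroExt_mul_exp _ f₂ x hv1, h2 v hv.1,
    h2 _ hv1, ← hφ.2, ← hψ.2, h3, betaIntegrand]
  simp only [map_mul, map_add, Complex.conj_ofReal, Complex.ofReal_mul, Complex.ofReal_add]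
  ring

theorem intervalIntegrable_convIntegrand {γ : ℝ} (hγ : 0 < γ) {f₁ f₂ : RPos → ℂ}
    (h₁ : f₁ ∈ spaceZg ((γ - 1) / 2)) (h₂ : f₂ ∈ spaceZg ((γ - 1) / 2)) (t : RPos) :
    IntervalIntegrable (convIntegrand f₁ f₂ t) volume 0 t := by
  obtain ⟨φ, hφ, r, hr, C, hC⟩ := h₁
  obtain ⟨ψ, hψ, s, hs, D, hD⟩ := h₂
  obtain ⟨x, rfl⟩ : ∃ x, t = expPos x := ⟨_, (expPos_log t).symm⟩
  have hc : Real.exp x ≠ 0 := (Real.exp_pos x).ne'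
  have h := (IntervalIntegrable.comp_mul_left_iff (f := convIntegrand f₁ f₂ (expPos x))
    (a := 0) (b := Real.exp x) hc (by finiteness) (by finiteness)).1
  refine h ?_
  rw [zero_div, div_self hc, intervalIntegrable_iff_integrableOn_Ioo_of_le zero_le_one]
  refine IntegrableOn.congr_fun (Integrable.const_mul (integrableOn_betaIntegrand (a := γ / 2)
    (by positivity) hC.conj hD hφ.conj.1.continuous hψ.1.continuous x)
    (Real.exp ((γ - 2) * x) : ℂ)) (fun v hv => ?_) measurableSet_Ioo
  exact (convIntegrand_mul_exp γ hφ hψ x hv).symm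

/-- The powers of `e^x` cancel: `1 - γ` from `toLine`, `1` from the Jacobian, `γ - 2` from the
integrand. What remains makes sense for complex `x`, which gives the entire extension. -/
theorem toLine_laplaceConv (γ : ℝ) {f₁ f₂ : RPos → ℂ} {φ ψ : ℂ → ℂ}
    (hφ : IsEntireExt (toLine ((γ - 1) / 2) f₁) φ) (hψ : IsEntireExt (toLine ((γ - 1) / 2) f₂) ψ)
    (x : ℝ) : toLine (γ - 1 / 2) (laplaceConv f₁ f₂) x = ∫ v in Set.Ioo (0 : ℝ) 1,
      betaIntegrand (γ / 2) (fun z => starRingEnd ℂ (φ (starRingEnd ℂ z))) ψ x v := by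
  show (Real.exp ((1 / 2 - (γ - 1 / 2)) * x) : ℂ) * laplaceConv f₁ f₂ (expPos x) = _
  have h1 : laplaceConv f₁ f₂ (expPos x) = (Real.exp x : ℂ) * ∫ v in Set.Ioo (0 : ℝ) 1,
      convIntegrand f₁ f₂ (expPos x) (Real.exp x * v) := by
    have h := intervalIntegral.smul_integral_comp_mul_left (a := 0) (b := 1)
      (convIntegrand f₁ f₂ (expPos x)) (Real.exp x)
    rw [mul_zero, mul_one, intervalIntegral.integral_of_le zero_le_one,
      integral_Ioc_eq_integral_Ioo] at h
    rw [laplaceConv, ← Complex.real_smul, h]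
    rfl
  rw [h1, setIntegral_congr_fun measurableSet_Ioo
    (fun v hv => convIntegrand_mul_exp γ hφ hψ x hv), integral_const_mul, ← mul_assoc, ← mul_assoc,
    ← Complex.ofReal_mul, ← Complex.ofReal_mul, ← Real.exp_add, ← Real.exp_add]
  ring_nf
  simp

theorem laplaceConv_mem {γ : ℝ} (hγ : 0 < γ) {f₁ f₂ : RPos → ℂ}
    (h₁ : f₁ ∈ spaceZg ((γ - 1) / 2)) (h₂ : f₂ ∈ spaceZg ((γ - 1) / 2)) :
    laplaceConv f₁ f₂ ∈ spaceZg (γ - 1 / 2) := by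
  obtain ⟨φ, hφ, r, hr, C, hC⟩ := h₁
  obtain ⟨ψ, hψ, s, hs, D, hD⟩ := h₂
  have ha : 0 < γ / 2 := by positivity
  exact ⟨_, ⟨differentiable_betaIntegral ha hr.le hs.le hC.conj hD hφ.conj.1 hψ.1,
    fun x => (toLine_laplaceConv γ hφ hψ x).symm⟩, r + s, by positivity, _,
    betaIntegral_bound ha hC.conj hD⟩

/-- Since `e^(-t lam) = e^(-s lam) e^(-(t-s) lam)`, this is the integral of a convolution of two
integrable functions on the half-line. -/
theorem laplace_laplaceConv {f₁ f₂ : RPos → ℂ} {lam : RPos}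
    (h₁ : IntegrableOn (laplaceIntegrand f₁ lam) (Set.Ioi 0))
    (h₂ : IntegrableOn (laplaceIntegrand f₂ lam) (Set.Ioi 0)) :
    laplace (laplaceConv f₁ f₂) lam = conjMul (laplace f₁) (laplace f₂) lam := by
  have h₁' : IntegrableOn (fun t => starRingEnd ℂ (laplaceIntegrand f₁ lam t)) (Set.Ioi 0) :=
    Complex.conjLIE.integrable_comp_iff.2 h₁
  have h := integral_posConvolution h₁' h₂ (ContinuousLinearMap.mul ℝ ℂ)
  rw [integral_conj] at h
  simp only [ContinuousLinearMap.mul_apply'] at h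
  rw [conjMul, laplace, laplace, laplace, ← h]
  refine setIntegral_congr_fun measurableSet_Ioi fun t (ht : 0 < t) => ?_
  simp only [laplaceIntegrand]
  rw [zeroExt_of_pos _ ht, laplaceConv, ← intervalIntegral.integral_const_mul]
  refine intervalIntegral.integral_congr fun s _ => ?_
  simp only [convIntegrand, map_mul, Complex.conj_ofReal]
  have : Real.exp (-(t * lam)) = Real.exp (-(s * lam)) * Real.exp (-((t - s) * lam)) := by
    rw [← Real.exp_add]
    congr 1
    ring
  rw [this, Complex.ofReal_mul]
  ring

/-! ### Adjoints on the dual spaces -/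

/-- The topology is induced by evaluations, and evaluating `T σ` at `F` is evaluating `σ` at `S F`.
-/
theorem pairing_comp_continuous {γ δ : ℝ} (T : dualZg γ → dualZg δ) (S : spaceZg δ → spaceZg γ)
    (h : ∀ σ F, pairing (T σ) F = pairing σ (S F)) : Continuous T := by
  refine continuous_induced_rng.2 (continuous_pi fun F => ?_)
  have h1 : (fun σ => pairing (T σ) F) = fun σ : dualZg γ => pairing σ (S F) :=
    funext fun σ => h σ F
  show Continuous fun σ => pairing (T σ) F
  rw [h1]
  exact (continuous_apply (S F)).comp continuous_induced_dom

/-- The adjoint of a linear isomorphism which is continuous, with its inverse, with respect to the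
convergence of sequences. -/
def adjointEquiv {γ δ : ℝ} (L : spaceZg γ ≃ₗ[ℂ] spaceZg δ)
    (hL : ∀ f : ℕ → spaceZg γ, TendstoZero f → TendstoZero fun k => L (f k))
    (hL' : ∀ g : ℕ → spaceZg δ, TendstoZero g → TendstoZero fun k => L.symm (g k)) :
    dualZg δ ≃L[ℂ] dualZg γ where
  toFun σ := ⟨σ.1.comp L.toLinearMap, fun f hf => σ.2 _ (hL f hf)⟩
  invFun h := ⟨h.1.comp L.symm.toLinearMap, fun g hg => h.2 _ (hL' g hg)⟩
  map_add' _ _ := rfl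
  map_smul' _ _ := rfl
  left_inv σ := by
    ext F
    exact congrArg σ.1 (L.apply_symm_apply F)
  right_inv h := by
    ext F
    exact congrArg h.1 (L.symm_apply_apply F)
  continuous_toFun := pairing_comp_continuous _ L fun _ _ => rfl
  continuous_invFun := pairing_comp_continuous _ L.symm fun _ _ => rfl

theorem pairing_adjointEquiv {γ δ : ℝ} (L : spaceZg γ ≃ₗ[ℂ] spaceZg δ)
    (hL : ∀ f : ℕ → spaceZg γ, TendstoZero f → TendstoZero fun k => L (f k))
    (hL' : ∀ g : ℕ → spaceZg δ, TendstoZero g → TendstoZero fun k => L.symm (g k))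
    (σ : dualZg δ) (F : spaceZg γ) :
    pairing (adjointEquiv L hL hL' σ) F = pairing σ (L F) := rfl

end HankelSigma

end

theorem theorem4p14 (γ : ℝ) (hγ : 0 < γ) :
    -- the Laplace integral converges absolutely on the space `𝒵_{γ-1/2}`
    (∀ f : HankelSigma.spaceZg (γ - 1 / 2), ∀ lam : HankelSigma.RPos,
      IntegrableOn (HankelSigma.laplaceIntegrand f lam) (Set.Ioi (0 : ℝ))) ∧
    -- the Laplace transform is an isomorphism of `𝒵_{γ-1/2}` onto `𝒵_{1/2-γ}`
    ∃ L : HankelSigma.spaceZg (γ - 1 / 2) ≃ₗ[ℂ] HankelSigma.spaceZg (1 / 2 - γ),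
      (∀ f, (L f : HankelSigma.RPos → ℂ) = HankelSigma.laplace f) ∧
      (∀ f : ℕ → HankelSigma.spaceZg (γ - 1 / 2),
        HankelSigma.TendstoZero f → HankelSigma.TendstoZero fun k => L (f k)) ∧
      (∀ g : ℕ → HankelSigma.spaceZg (1 / 2 - γ),
        HankelSigma.TendstoZero g → HankelSigma.TendstoZero fun k => L.symm (g k)) ∧
      -- its adjoint is an isomorphism of the dual spaces
      ∃ Lstar : HankelSigma.dualZg (1 / 2 - γ) ≃L[ℂ] HankelSigma.dualZg (γ - 1 / 2),
        (∀ σ F, HankelSigma.pairing (Lstar σ) F = HankelSigma.pairing σ (L F)) ∧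
        -- the main identity, for `σ = (L^*)⁻¹ h`
        ∀ (h : HankelSigma.dualZg (γ - 1 / 2)) (σ : HankelSigma.dualZg (1 / 2 - γ)),
          σ = Lstar.symm h →
          ∀ f₁ f₂ : HankelSigma.spaceZg ((γ - 1) / 2),
            (∀ t : HankelSigma.RPos, IntervalIntegrable
              (HankelSigma.convIntegrand f₁ f₂ t) volume 0 t) ∧
            ∃ (hF : HankelSigma.laplaceConv f₁ f₂ ∈ HankelSigma.spaceZg (γ - 1 / 2))
              (hw : HankelSigma.conjMul (HankelSigma.laplace f₁) (HankelSigma.laplace f₂) ∈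
                HankelSigma.spaceZg (1 / 2 - γ)),
              HankelSigma.pairing h ⟨HankelSigma.laplaceConv f₁ f₂, hF⟩ =
                HankelSigma.pairing σ
                  ⟨HankelSigma.conjMul (HankelSigma.laplace f₁) (HankelSigma.laplace f₂), hw⟩ := by
  refine ⟨fun f lam => HankelSigma.integrableOn_laplaceIntegrand hγ f.2 lam,
    HankelSigma.laplaceEquiv hγ, HankelSigma.coe_laplaceEquiv hγ,
    fun _ => HankelSigma.tendstoZero_laplaceEquiv hγ,
    fun _ => HankelSigma.tendstoZero_laplaceEquiv_symm hγ,
    HankelSigma.adjointEquiv _ (fun _ => HankelSigma.tendstoZero_laplaceEquiv hγ)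
      (fun _ => HankelSigma.tendstoZero_laplaceEquiv_symm hγ),
    HankelSigma.pairing_adjointEquiv _ _ _, ?_⟩
  rintro h σ hσ ⟨f₁, h₁⟩ ⟨f₂, h₂⟩
  have hγ2 : 0 < γ / 2 := by positivity
  -- In this form the results on the Laplace transform apply to `f₁` and `f₂` with `γ / 2` in place
  -- of `γ`.
  have heq : (γ - 1) / 2 = γ / 2 - 1 / 2 := by ring
  have h₁' : f₁ ∈ HankelSigma.spaceZg (γ / 2 - 1 / 2) := heq ▸ h₁
  have h₂' : f₂ ∈ HankelSigma.spaceZg (γ / 2 - 1 / 2) := heq ▸ h₂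
  refine ⟨HankelSigma.intervalIntegrable_convIntegrand hγ h₁ h₂,
    HankelSigma.laplaceConv_mem hγ h₁ h₂, HankelSigma.conjMul_mem
      (HankelSigma.laplace_mem hγ2 h₁') (HankelSigma.laplace_mem hγ2 h₂'), ?_⟩
  rw [ContinuousLinearEquiv.eq_symm_apply] at hσ
  rw [← hσ, HankelSigma.pairing_adjointEquiv]
  congr 1
  ext lam
  exact HankelSigma.laplace_laplaceConv
    (HankelSigma.integrableOn_laplaceIntegrand hγ2 h₁' lam)
    (HankelSigma.integrableOn_laplaceIntegrand hγ2 h₂' lam)
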